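/- Let $K$ be a field, let $C$ and $D$ be coalgebras over $K$, and let $\lambda: C\to D$ be a morphism of coalgebras. Let $U:\mathcal{M}^C\to\mathcal{M}^D$ be the corestriction functor between the categories of right comodules, which sends a right $C$-comodule $M$ with coaction $m\mapsto m_0\otimes m_1$ to $M$ with the right $D$-coaction $m\mapsto m_0\otimes\lambda(m_1)$, and which is the identity on the underlying linear maps of morphisms. Suppose that $\lambda$ is a (right) Frobenius extension of coalgebras, that is, $U$ is a Frobenius functor: it has both a left adjoint and a right adjoint, and these are naturally isomorphic. Then $C$, with the coaction $c\mapsto\lambda(c_1)\otimes c_2$, is an injective object of the category of left $D$-comodules, and $C$, with the coaction $c\mapsto c_1\otimes\lambda(c_2)$, is an injective object of the category of right $D$-comodules. -/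

import Mathlib

open CategoryTheory TensorProduct

universe u v v₁ u₁ v₂ u₂

/-- A functor is Frobenius if it has a left adjoint and a right adjoint, and these two are
naturally isomorphic. -/
def CategoryTheory.Functor.IsFrobenius {A : Type u₁} [Category.{v₁} A] {B : Type u₂}
    [Category.{v₂} B] (U : A ⥤ B) : Prop :=
  ∃ L R : B ⥤ A, Nonempty (L ⊣ U) ∧ Nonempty (U ⊣ R) ∧ Nonempty (L ≅ R)

/-- Right comodules `(M, ρ : M → M ⊗ C)` over a `K`-coalgebra `C`. -/
structure RightComod (K : Type u) [CommRing K] (C : Type v) [AddCommGroup C] [Module K C]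
    [Coalgebra K C] where
  carrier : Type v
  [addCommGroup : AddCommGroup carrier]
  [module : Module K carrier]
  /-- the coaction `ρ(m) = m₀ ⊗ m₁` -/
  coact : carrier →ₗ[K] carrier ⊗[K] C
  /-- `m₀₀ ⊗ m₀₁ ⊗ m₁ = m₀ ⊗ m₁₁ ⊗ m₁₂` -/
  coassoc : (TensorProduct.assoc K carrier C C).toLinearMap ∘ₗ coact.rTensor C ∘ₗ coact =
    (CoalgebraStruct.comul (R := K) (A := C)).lTensor carrier ∘ₗ coact
  /-- `m₀ ε(m₁) = m` -/
  counit_coact : (TensorProduct.rid K carrier).toLinearMap ∘ₗ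
    (CoalgebraStruct.counit (R := K) (A := C)).lTensor carrier ∘ₗ coact = LinearMap.id

/-- Left comodules `(M, ρ : M → C ⊗ M)` over a `K`-coalgebra `C`. -/
structure LeftComod (K : Type u) [CommRing K] (C : Type v) [AddCommGroup C] [Module K C]
    [Coalgebra K C] where
  carrier : Type v
  [addCommGroup : AddCommGroup carrier]
  [module : Module K carrier]
  /-- the coaction `ρ(m) = m₋₁ ⊗ m₀` -/
  coact : carrier →ₗ[K] C ⊗[K] carrier
  /-- `m₋₁₁ ⊗ m₋₁₂ ⊗ m₀ = m₋₁ ⊗ m₀₋₁ ⊗ m₀₀` -/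
  coassoc : (TensorProduct.assoc K C C carrier).toLinearMap ∘ₗ
      (CoalgebraStruct.comul (R := K) (A := C)).rTensor carrier ∘ₗ coact =
    coact.lTensor C ∘ₗ coact
  /-- `ε(m₋₁) m₀ = m` -/
  counit_coact : (TensorProduct.lid K carrier).toLinearMap ∘ₗ
    (CoalgebraStruct.counit (R := K) (A := C)).rTensor carrier ∘ₗ coact = LinearMap.id

attribute [instance] RightComod.addCommGroup RightComod.module
attribute [instance] LeftComod.addCommGroup LeftComod.module

namespace RightComod

section Category

variable {K : Type u} [CommRing K] {C : Type v} [AddCommGroup C] [Module K C] [Coalgebra K C]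

/-- Colinear maps of right comodules: `f(m)₀ ⊗ f(m)₁ = f(m₀) ⊗ m₁`. -/
@[ext]
structure Hom (M N : RightComod K C) where
  toLin : M.carrier →ₗ[K] N.carrier
  comm : N.coact ∘ₗ toLin = toLin.rTensor C ∘ₗ M.coact

instance : Category (RightComod K C) where
  Hom := Hom
  id M := ⟨LinearMap.id, by simp⟩
  comp f g := ⟨g.toLin ∘ₗ f.toLin, by
    rw [← LinearMap.comp_assoc, g.comm, LinearMap.comp_assoc, f.comm, LinearMap.rTensor_comp,
      LinearMap.comp_assoc]⟩

end Category

section Constructions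

variable (K : Type u) [CommRing K] (C : Type v) [AddCommGroup C] [Module K C] [Coalgebra K C]

/-- `C` as a right comodule over itself, with coaction `Δ`. -/
def regular : RightComod K C where
  carrier := C
  coact := CoalgebraStruct.comul
  coassoc := Coalgebra.coassoc
  counit_coact := by
    rw [Coalgebra.lTensor_counit_comp_comul]
    ext x
    simp

variable {K C} {D : Type v} [AddCommGroup D] [Module K D] [Coalgebra K D]

/-- The right `D`-comodule `(M, m ↦ m₀ ⊗ f(m₁))` of a right `C`-comodule `M`. -/
def corestrict (f : C →ₗc[K] D) (M : RightComod K C) : RightComod K D where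
  carrier := M.carrier
  coact := f.toLinearMap.lTensor M.carrier ∘ₗ M.coact
  coassoc := by
    have h1 : (f.toLinearMap.lTensor M.carrier ∘ₗ M.coact).rTensor D ∘ₗ
        f.toLinearMap.lTensor M.carrier =
        TensorProduct.map (TensorProduct.map LinearMap.id f.toLinearMap) f.toLinearMap ∘ₗ
          M.coact.rTensor C := by
      ext m c
      simp [LinearMap.lTensor]
    have h2 : (TensorProduct.assoc K M.carrier D D).toLinearMap ∘ₗ
        TensorProduct.map (TensorProduct.map LinearMap.id f.toLinearMap) f.toLinearMap =
        (TensorProduct.map f.toLinearMap f.toLinearMap).lTensor M.carrier ∘ₗ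
          (TensorProduct.assoc K M.carrier C C).toLinearMap := by
      ext m c c'
      simp
    rw [← LinearMap.comp_assoc (M.coact), h1, LinearMap.comp_assoc, ← LinearMap.comp_assoc, h2,
      LinearMap.comp_assoc, M.coassoc, ← LinearMap.comp_assoc, ← LinearMap.comp_assoc,
      ← LinearMap.lTensor_comp, ← LinearMap.lTensor_comp, f.map_comp_comul]
  counit_coact := by
    rw [← LinearMap.comp_assoc (M.coact), ← LinearMap.lTensor_comp, f.counit_comp]
    exact M.counit_coact

/-- The corestriction functor from right `C`-comodules to right `D`-comodules along a coalgebra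
morphism `f : C → D`; it does not change the underlying linear maps. -/
def corestriction (f : C →ₗc[K] D) : RightComod K C ⥤ RightComod K D where
  obj := corestrict f
  map {M N} g := ⟨g.toLin, by
    change (f.toLinearMap.lTensor N.carrier ∘ₗ N.coact) ∘ₗ g.toLin =
      g.toLin.rTensor D ∘ₗ f.toLinearMap.lTensor M.carrier ∘ₗ M.coact
    rw [LinearMap.comp_assoc, g.comm, ← LinearMap.comp_assoc, ← LinearMap.comp_assoc,
      LinearMap.lTensor_comp_rTensor, LinearMap.rTensor_comp_lTensor]⟩

end Constructions

end RightComod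

namespace LeftComod

section Category

variable {K : Type u} [CommRing K] {C : Type v} [AddCommGroup C] [Module K C] [Coalgebra K C]

/-- Colinear maps of left comodules: `f(m)₋₁ ⊗ f(m)₀ = m₋₁ ⊗ f(m₀)`. -/
@[ext]
structure Hom (M N : LeftComod K C) where
  toLin : M.carrier →ₗ[K] N.carrier
  comm : N.coact ∘ₗ toLin = toLin.lTensor C ∘ₗ M.coact

instance : Category (LeftComod K C) where
  Hom := Hom
  id M := ⟨LinearMap.id, by simp⟩
  comp f g := ⟨g.toLin ∘ₗ f.toLin, by
    rw [← LinearMap.comp_assoc, g.comm, LinearMap.comp_assoc, f.comm, LinearMap.lTensor_comp,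
      LinearMap.comp_assoc]⟩

end Category

section Constructions

variable (K : Type u) [CommRing K] (C : Type v) [AddCommGroup C] [Module K C] [Coalgebra K C]

/-- `C` as a left comodule over itself, with coaction `Δ`. -/
def regular : LeftComod K C where
  carrier := C
  coact := CoalgebraStruct.comul
  coassoc := Coalgebra.coassoc
  counit_coact := by
    rw [Coalgebra.rTensor_counit_comp_comul]
    ext x
    simp

variable {K C} {D : Type v} [AddCommGroup D] [Module K D] [Coalgebra K D]

/-- The left `D`-comodule `(M, m ↦ f(m₋₁) ⊗ m₀)` of a left `C`-comodule `M`. -/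
def corestrict (f : C →ₗc[K] D) (M : LeftComod K C) : LeftComod K D where
  carrier := M.carrier
  coact := f.toLinearMap.rTensor M.carrier ∘ₗ M.coact
  coassoc := by
    have h1 : (f.toLinearMap.rTensor M.carrier ∘ₗ M.coact).lTensor D ∘ₗ
        f.toLinearMap.rTensor M.carrier =
        TensorProduct.map f.toLinearMap (TensorProduct.map f.toLinearMap LinearMap.id) ∘ₗ
          M.coact.lTensor C := by
      ext m c
      simp [LinearMap.rTensor]
    have h2 : (TensorProduct.assoc K D D M.carrier).toLinearMap ∘ₗ
        (TensorProduct.map f.toLinearMap f.toLinearMap).rTensor M.carrier =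
        TensorProduct.map f.toLinearMap (TensorProduct.map f.toLinearMap LinearMap.id) ∘ₗ
          (TensorProduct.assoc K C C M.carrier).toLinearMap := by
      ext c c' m
      simp
    have h3 : (CoalgebraStruct.comul (R := K) (A := D)).rTensor M.carrier ∘ₗ
        f.toLinearMap.rTensor M.carrier =
        (TensorProduct.map f.toLinearMap f.toLinearMap).rTensor M.carrier ∘ₗ
          (CoalgebraStruct.comul (R := K) (A := C)).rTensor M.carrier := by
      rw [← LinearMap.rTensor_comp, ← LinearMap.rTensor_comp, f.map_comp_comul]
    rw [← LinearMap.comp_assoc (M.coact) _ (LinearMap.lTensor D _), h1, LinearMap.comp_assoc,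
      ← M.coassoc, ← LinearMap.comp_assoc (M.coact), h3, LinearMap.comp_assoc,
      ← LinearMap.comp_assoc, h2, LinearMap.comp_assoc]
  counit_coact := by
    rw [← LinearMap.comp_assoc (M.coact), ← LinearMap.rTensor_comp, f.counit_comp]
    exact M.counit_coact

end Constructions

end LeftComod

/-- A morphism of coalgebras `f : C → D` is a (right) Frobenius extension if the corestriction
functor from right `C`-comodules to right `D`-comodules is a Frobenius functor. -/
def CoalgHom.IsFrobeniusExtension {K : Type u} [CommRing K] {C D : Type v}
    [AddCommGroup C] [Module K C] [Coalgebra K C] [AddCommGroup D] [Module K D] [Coalgebra K D]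
    (f : C →ₗc[K] D) : Prop :=
  (RightComod.corestriction f).IsFrobenius

/-! Write `U` for corestriction and `R` for its two-sided adjoint. On the right the claim is formal:
`U ⊣ R` makes `R` preserve monomorphisms, so `R ⊣ U` makes `U` preserve injectives, and `C` is
injective over itself.

On the left, `U` says nothing directly about left comodules; their structure enters through
naturality. The maps c ↦ φ(c₁)c₂ are right colinear endomorphisms of `C`, and compatibility with
them for every functional φ encodes left colinearity. It suffices to find a left `D`-colinear
retraction of c ↦ f(c₁) ⊗ c₂ (`LeftComod.injective_of_retraction`).

The unit of `R ⊣ U` at `D`, followed by a map R D → C, gives η : D → C, which is left colinear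
(`unitLin_left_colinear`). The object R U C embeds in C ⊗ C, and there the counit R U C → C takes
the form x ⊗ y ↦ x₁β(x₂ ⊗ y). The retraction is d ⊗ c ↦ η(d)₁β(η(d)₂ ⊗ c); a triangle identity for
`R ⊣ U` makes it split the coaction (`exists_hitTensor_unitLin`). -/

lemma CategoryTheory.Adjunction.map_unit_comp_map_comp_counit {A : Type u₁} [Category.{v₁} A]
    {B : Type u₂} [Category.{v₂} B] {F : A ⥤ B} {G : B ⥤ A} (adj : F ⊣ G) {X : A} {Y : B}
    (k : F.obj X ⟶ Y) : F.map (adj.unit.app X ≫ G.map k) ≫ adj.counit.app Y = k := by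
  simp

/-! ### Vector spaces: separating tensors and extending maps. -/

section LinearAlgebra

variable {K : Type*} [Field K]

lemma TensorProduct.eq_of_forall_dual_rTensor {V W : Type*} [AddCommGroup V] [Module K V]
    [AddCommGroup W] [Module K W] {x y : V ⊗[K] W}
    (h : ∀ φ : V →ₗ[K] K, φ.rTensor W x = φ.rTensor W y) : x = y := by
  classical
  let b := Module.Basis.ofVectorSpace K V
  apply (TensorProduct.equivFinsuppOfBasisLeft (N := W) b).injective
  ext i
  have key : ∀ z : V ⊗[K] W, TensorProduct.equivFinsuppOfBasisLeft (N := W) b z i =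
      TensorProduct.lid K W ((b.coord i).rTensor W z) := by
    intro z
    induction z with
    | zero => simp
    | tmul v w => simp
    | add z z' hz hz' => simp [hz, hz']
  rw [key, key, h]

lemma LinearMap.exists_extend_of_injective {V W : Type*} [AddCommGroup V] [Module K V]
    [AddCommGroup W] [Module K W] {i : V →ₗ[K] W} (hi : Function.Injective i) {X : Type*}
    [AddCommGroup X] [Module K X] (g : V →ₗ[K] X) : ∃ g' : W →ₗ[K] X, g' ∘ₗ i = g := by
  obtain ⟨l, hl⟩ := i.exists_leftInverse_of_injective (LinearMap.ker_eq_bot.2 hi)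
  exact ⟨g ∘ₗ l, by rw [LinearMap.comp_assoc, hl, LinearMap.comp_id]⟩

end LinearAlgebra

/-! ### Actions of functionals on a coalgebra. -/

section Hit

variable {K : Type*} [CommRing K] {C : Type*} [AddCommGroup C] [Module K C] [Coalgebra K C]

/-- The map `c ↦ c₁ b(c₂)`. -/
noncomputable def hitLeft (b : C →ₗ[K] K) : C →ₗ[K] C :=
  (TensorProduct.rid K C).toLinearMap ∘ₗ b.lTensor C ∘ₗ CoalgebraStruct.comul

lemma comul_comp_hitLeft (b : C →ₗ[K] K) :
    CoalgebraStruct.comul ∘ₗ hitLeft b = (hitLeft b).lTensor C ∘ₗ CoalgebraStruct.comul := by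
  ext c
  have h1 : ∀ t : C ⊗[K] C, CoalgebraStruct.comul (R := K) (TensorProduct.rid K C (b.lTensor C t)) =
      (TensorProduct.rid K C ∘ₗ b.lTensor C).lTensor C
        (TensorProduct.assoc K C C C (CoalgebraStruct.comul.rTensor C t)) := by
    intro t
    induction t with
    | zero => simp
    | add t t' h h' => simp only [map_add, h, h']
    | tmul x y =>
      simp only [LinearMap.lTensor_tmul, LinearMap.rTensor_tmul, TensorProduct.rid_tmul, map_smul]
      generalize CoalgebraStruct.comul (R := K) x = s
      induction s with
      | zero => simp
      | add t t' h h' => simp only [map_add, TensorProduct.add_tmul, smul_add, h, h']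
      | tmul x y => simp
  simp only [LinearMap.comp_apply, hitLeft, LinearEquiv.coe_coe]
  rw [h1, Coalgebra.coassoc_apply, ← LinearMap.comp_apply (LinearMap.lTensor C _),
    ← LinearMap.lTensor_comp]
  rfl

/-- The map `x ⊗ y ↦ x₁ β(x₂ ⊗ y)`. -/
noncomputable def hitTensor (β : C ⊗[K] C →ₗ[K] K) : C ⊗[K] C →ₗ[K] C :=
  (TensorProduct.rid K C).toLinearMap ∘ₗ β.lTensor C ∘ₗ
    (TensorProduct.assoc K C C C).toLinearMap ∘ₗ CoalgebraStruct.comul.rTensor C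

lemma hitTensor_tmul (β : C ⊗[K] C →ₗ[K] K) (x y : C) :
    hitTensor β (x ⊗ₜ y) = hitLeft (β ∘ₗ (TensorProduct.mk K C C).flip y) x := by
  simp only [hitTensor, hitLeft, LinearMap.comp_apply, LinearMap.rTensor_tmul, LinearEquiv.coe_coe]
  generalize CoalgebraStruct.comul (R := K) x = s
  induction s with
  | zero => simp
  | add t t' h h' => simp only [map_add, TensorProduct.add_tmul, h, h']
  | tmul x y => simp

/-- The map `c ↦ φ(c₁) c₂`. -/
noncomputable def hitRight (φ : C →ₗ[K] K) : C →ₗ[K] C :=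
  (TensorProduct.lid K C).toLinearMap ∘ₗ φ.rTensor C ∘ₗ CoalgebraStruct.comul

/-- Both sides are φ(x₁)β(x₂ ⊗ y) on x ⊗ y. This is how a map into `C` is reconstructed from its
composite with the counit. -/
lemma dual_hitTensor (φ : C →ₗ[K] K) (β : C ⊗[K] C →ₗ[K] K) (z : C ⊗[K] C) :
    φ (hitTensor β z) = β ((hitRight φ).rTensor C z) := by
  induction z with
  | zero => simp
  | add t t' h h' => simp only [map_add, h, h']
  | tmul x y =>
    simp only [hitTensor, hitRight, LinearMap.comp_apply, LinearMap.rTensor_tmul,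
      LinearEquiv.coe_coe]
    generalize CoalgebraStruct.comul (R := K) x = s
    induction s with
    | zero => simp
    | add t t' h h' => simp only [map_add, TensorProduct.add_tmul, h, h']
    | tmul x z => simp [← TensorProduct.smul_tmul', mul_comm]

/-- If `η : D → C` is left `D`-colinear, then so is `d ⊗ c ↦ η(d)₁ β(η(d)₂ ⊗ c)`. -/
lemma hitTensor_comp_rTensor_colinear {D : Type*} [AddCommGroup D] [Module K D] [Coalgebra K D]
    (f : C →ₗ[K] D) (η : D →ₗ[K] C) (β : C ⊗[K] C →ₗ[K] K)
    (hη : f.rTensor C ∘ₗ CoalgebraStruct.comul ∘ₗ η = η.lTensor D ∘ₗ CoalgebraStruct.comul) :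
    (f.rTensor C ∘ₗ CoalgebraStruct.comul) ∘ₗ hitTensor β ∘ₗ η.rTensor C =
      (hitTensor β ∘ₗ η.rTensor C).lTensor D ∘ₗ (TensorProduct.assoc K D D C).toLinearMap ∘ₗ
        CoalgebraStruct.comul.rTensor C := by
  ext d c
  -- For fixed c the map is `hitLeft b` after η, and `hitLeft b` is left `C`-colinear by
  -- coassociativity.
  set b := β ∘ₗ (TensorProduct.mk K C C).flip c with hb
  have h1 : ∀ t : D ⊗[K] D, (hitTensor β ∘ₗ η.rTensor C).lTensor D
      (TensorProduct.assoc K D D C (t ⊗ₜ c)) = (hitLeft b).lTensor D (η.lTensor D t) := by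
    intro t
    induction t with
    | zero => simp
    | add t t' h h' => simp only [map_add, TensorProduct.add_tmul, h, h']
    | tmul x y => simp [hitTensor_tmul, hb]
  have h2 := LinearMap.congr_fun (comul_comp_hitLeft b) (η d)
  have h3 := LinearMap.congr_fun hη d
  simp only [LinearMap.comp_apply] at h2 h3
  simp only [TensorProduct.AlgebraTensorModule.curry_apply, LinearMap.restrictScalars_self,
    TensorProduct.curry_apply, LinearMap.comp_apply, LinearMap.rTensor_tmul, LinearEquiv.coe_coe]
  rw [h1, hitTensor_tmul, ← hb, h2, ← h3, ← LinearMap.comp_apply (f.rTensor C),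
    ← LinearMap.comp_apply (LinearMap.lTensor D _), LinearMap.rTensor_comp_lTensor,
    LinearMap.lTensor_comp_rTensor]

end Hit

/-! ### Right comodules: cofree objects, monomorphisms, injectivity of `C`. -/

namespace RightComod

section Basic

variable {K : Type u} [CommRing K] {C : Type v} [AddCommGroup C] [Module K C] [Coalgebra K C]

lemma hom_ext {M N : RightComod K C} {f g : M ⟶ N} (h : Hom.toLin f = Hom.toLin g) : f = g :=
  Hom.ext h

lemma counit_coact_apply (M : RightComod K C) (m : M.carrier) :
    TensorProduct.rid K M.carrier (CoalgebraStruct.counit.lTensor M.carrier (M.coact m)) = m :=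
  LinearMap.congr_fun M.counit_coact m

/-- The coaction of the cofree right comodule `V ⊗ C`. -/
noncomputable def cofreeCoact (K : Type u) [CommRing K] (C : Type v) [AddCommGroup C] [Module K C]
    [Coalgebra K C] (V : Type v) [AddCommGroup V] [Module K V] : V ⊗[K] C →ₗ[K] V ⊗[K] C ⊗[K] C :=
  (TensorProduct.assoc K V C C).symm.toLinearMap ∘ₗ CoalgebraStruct.comul.lTensor V

lemma cofreeCoact_rTensor {V W : Type v} [AddCommGroup V] [Module K V] [AddCommGroup W]
    [Module K W] (g : W →ₗ[K] V) (t : W ⊗[K] C) :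
    cofreeCoact K C V (g.rTensor C t) = (g.rTensor C).rTensor C (cofreeCoact K C W t) := by
  induction t with
  | zero => simp
  | add t t' h h' => simp only [map_add, h, h']
  | tmul x y =>
    simp only [cofreeCoact, LinearMap.comp_apply, LinearMap.rTensor_tmul, LinearMap.lTensor_tmul,
      LinearEquiv.coe_coe]
    generalize CoalgebraStruct.comul (R := K) y = s
    induction s with
    | zero => simp
    | add t t' h h' => simp only [map_add, TensorProduct.tmul_add, h, h']
    | tmul x y => simp

variable (C) in
/-- The cofree right comodule `V ⊗ C`. -/
noncomputable def cofree (V : Type v) [AddCommGroup V] [Module K V] : RightComod K C where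
  carrier := V ⊗[K] C
  coact := cofreeCoact K C V
  coassoc := by
    ext v c
    have h : ∀ t : C ⊗[K] C, TensorProduct.assoc K (V ⊗[K] C) C C
        ((cofreeCoact K C V).rTensor C ((TensorProduct.assoc K V C C).symm (v ⊗ₜ t)))
        = (TensorProduct.assoc K V C (C ⊗[K] C)).symm
          (v ⊗ₜ TensorProduct.assoc K C C C (CoalgebraStruct.comul.rTensor C t)) := by
      intro t
      induction t with
      | zero => simp
      | add t t' h h' => simp only [map_add, TensorProduct.tmul_add, h, h']
      | tmul x y =>
        simp only [TensorProduct.assoc_symm_tmul, LinearMap.rTensor_tmul, LinearMap.comp_apply,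
          LinearMap.lTensor_tmul, LinearEquiv.coe_coe, cofreeCoact]
        generalize CoalgebraStruct.comul (R := K) x = s
        induction s with
        | zero => simp
        | add t t' h h' =>
          simp only [map_add, TensorProduct.tmul_add, TensorProduct.add_tmul, h, h']
        | tmul x y => simp
    have h2 : ∀ t : C ⊗[K] C, CoalgebraStruct.comul.lTensor (V ⊗[K] C)
        ((TensorProduct.assoc K V C C).symm (v ⊗ₜ t)) =
        (TensorProduct.assoc K V C (C ⊗[K] C)).symm
          (v ⊗ₜ (CoalgebraStruct.comul (R := K)).lTensor C t) := by
      intro t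
      induction t with
      | zero => simp
      | add t t' h h' => simp only [map_add, TensorProduct.tmul_add, h, h']
      | tmul x y => simp
    have h3 : cofreeCoact K C V (v ⊗ₜ c) =
        (TensorProduct.assoc K V C C).symm (v ⊗ₜ CoalgebraStruct.comul c) := rfl
    simp only [TensorProduct.AlgebraTensorModule.curry_apply, LinearMap.restrictScalars_self,
      TensorProduct.curry_apply, LinearMap.comp_apply, LinearEquiv.coe_coe]
    rw [h3, h, h2, Coalgebra.coassoc_apply]
  counit_coact := by
    ext v c
    have h : ∀ t : C ⊗[K] C, TensorProduct.rid K _ (CoalgebraStruct.counit.lTensor (V ⊗[K] C)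
        ((TensorProduct.assoc K V C C).symm (v ⊗ₜ t))) =
        v ⊗ₜ TensorProduct.rid K C ((CoalgebraStruct.counit (R := K)).lTensor C t) := by
      intro t
      induction t with
      | zero => simp
      | add t t' h h' => simp only [map_add, TensorProduct.tmul_add, h, h']
      | tmul x y => simp
    have h3 : cofreeCoact K C V (v ⊗ₜ c) =
        (TensorProduct.assoc K V C C).symm (v ⊗ₜ CoalgebraStruct.comul c) := rfl
    simp only [TensorProduct.AlgebraTensorModule.curry_apply, LinearMap.restrictScalars_self,
      TensorProduct.curry_apply, LinearMap.comp_apply, LinearEquiv.coe_coe]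
    rw [h3, h, Coalgebra.lTensor_counit_comul]
    simp

lemma cofreeCoact_coact (M : RightComod K C) (m : M.carrier) :
    cofreeCoact K C M.carrier (M.coact m) = M.coact.rTensor C (M.coact m) := by
  have h' := LinearMap.congr_fun M.coassoc m
  simp only [LinearMap.comp_apply, LinearEquiv.coe_coe] at h'
  simp only [cofreeCoact, LinearMap.comp_apply, LinearEquiv.coe_coe]
  rw [← h', LinearEquiv.symm_apply_apply]

/-- The colinear map `m ↦ g(m₀) ⊗ m₁` into a cofree comodule. -/
noncomputable def toCofree (M : RightComod K C) {V : Type v} [AddCommGroup V] [Module K V]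
    (g : M.carrier →ₗ[K] V) : M ⟶ cofree C V :=
  Hom.mk (g.rTensor C ∘ₗ M.coact) <| LinearMap.ext fun m => by
    refine (cofreeCoact_rTensor g (M.coact m)).trans ?_
    rw [cofreeCoact_coact, ← LinearMap.rTensor_comp_apply]
    rfl

lemma rid_counit_rTensor_coact (M : RightComod K C) {V : Type v} [AddCommGroup V] [Module K V]
    (g : M.carrier →ₗ[K] V) (m : M.carrier) :
    TensorProduct.rid K V (CoalgebraStruct.counit.lTensor V (g.rTensor C (M.coact m))) = g m := by
  have h : ∀ t : M.carrier ⊗[K] C,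
      TensorProduct.rid K V (CoalgebraStruct.counit.lTensor V (g.rTensor C t)) =
      g (TensorProduct.rid K M.carrier (CoalgebraStruct.counit.lTensor M.carrier t)) := by
    intro t
    induction t with
    | zero => simp
    | add t t' h h' => simp only [map_add, h, h']
    | tmul x y => simp
  exact (h _).trans (congrArg g (M.counit_coact_apply m))

/-- The linear map underlying a colinear map into the regular comodule. -/
def regularLin {M : RightComod K C} (h : M ⟶ regular K C) : M.carrier →ₗ[K] C := Hom.toLin h

lemma regularLin_comm {M : RightComod K C} (h : M ⟶ regular K C) :
    CoalgebraStruct.comul ∘ₗ regularLin h = (regularLin h).rTensor C ∘ₗ M.coact := Hom.comm h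

/-- The colinear map `m ↦ ψ(m₀) m₁` into the regular comodule. -/
noncomputable def toRegular (M : RightComod K C) (ψ : M.carrier →ₗ[K] K) : M ⟶ regular K C :=
  Hom.mk ((TensorProduct.lid K C).toLinearMap ∘ₗ ψ.rTensor C ∘ₗ M.coact) <| by
    ext m
    have h : ∀ t : M.carrier ⊗[K] C,
        CoalgebraStruct.comul (R := K) (TensorProduct.lid K C (ψ.rTensor C t)) =
        ((TensorProduct.lid K C).toLinearMap ∘ₗ ψ.rTensor C).rTensor C
          (cofreeCoact K C M.carrier t) := by
      intro t
      induction t with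
      | zero => simp
      | add t t' h h' => simp only [map_add, h, h']
      | tmul x y =>
        simp only [LinearMap.rTensor_tmul, LinearMap.lTensor_tmul, TensorProduct.lid_tmul, map_smul,
          cofreeCoact, LinearMap.comp_apply]
        generalize CoalgebraStruct.comul (R := K) y = s
        induction s with
        | zero => simp
        | add t t' h h' => simp only [map_add, TensorProduct.tmul_add, smul_add, h, h']
        | tmul x y => simp [TensorProduct.smul_tmul']
    refine (h _).trans ?_
    rw [cofreeCoact_coact, ← LinearMap.rTensor_comp_apply]
    rfl

lemma counit_comp_toRegular (M : RightComod K C) (ψ : M.carrier →ₗ[K] K) :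
    (CoalgebraStruct.counit (R := K) (A := C)) ∘ₗ regularLin (M.toRegular ψ) = ψ := by
  ext m
  have h : ∀ t : M.carrier ⊗[K] C,
      CoalgebraStruct.counit (R := K) (TensorProduct.lid K C (ψ.rTensor C t)) =
      ψ (TensorProduct.rid K M.carrier (CoalgebraStruct.counit.lTensor M.carrier t)) := by
    intro t
    induction t with
    | zero => simp
    | add t t' h h' => simp only [map_add, h, h']
    | tmul x y => simp [mul_comm]
  exact (h _).trans (congrArg ψ (M.counit_coact_apply m))

/-- The regular comodule is cofree on `K`: a colinear h is recovered from its functional ψ = ε ∘ h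
as m ↦ ψ(m₀)m₁. -/
lemma regular_hom_ext {M : RightComod K C} {g h : M ⟶ regular K C}
    (w : (CoalgebraStruct.counit (R := K) (A := C)) ∘ₗ regularLin g =
      (CoalgebraStruct.counit (R := K) (A := C)) ∘ₗ regularLin h) : g = h := by
  have key : ∀ h : M ⟶ regular K C, regularLin h = (TensorProduct.lid K C).toLinearMap ∘ₗ
      ((CoalgebraStruct.counit (R := K) (A := C)) ∘ₗ regularLin h).rTensor C ∘ₗ M.coact := by
    intro h
    rw [LinearMap.rTensor_comp, LinearMap.comp_assoc, ← regularLin_comm,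
      ← LinearMap.comp_assoc (regularLin h), Coalgebra.rTensor_counit_comp_comul]
    ext m
    simp
  apply hom_ext
  change regularLin g = regularLin h
  rw [key g, key h, w]

end Basic

section Field

variable {K : Type u} [Field K] {C : Type v} [AddCommGroup C] [Module K C] [Coalgebra K C]

/-- An injective linear map whose range is stable under the coaction is the inclusion of a
subcomodule. -/
noncomputable def ofInjective (M : RightComod K C) {W : Type v} [AddCommGroup W] [Module K W]
    (i : W →ₗ[K] M.carrier) (hi : Function.Injective i) (ρ : W →ₗ[K] W ⊗[K] C)
    (hρ : i.rTensor C ∘ₗ ρ = M.coact ∘ₗ i) : RightComod K C where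
  carrier := W
  coact := ρ
  coassoc := by
    have hρ' (w) : i.rTensor C (ρ w) = M.coact (i w) := LinearMap.congr_fun hρ w
    have e1 : ∀ t, i.rTensor (C ⊗[K] C) (TensorProduct.assoc K W C C t) =
        TensorProduct.assoc K M.carrier C C ((i.rTensor C).rTensor C t) :=
      LinearMap.congr_fun (f := i.rTensor (C ⊗[K] C) ∘ₗ (TensorProduct.assoc K W C C).toLinearMap)
        (g := (TensorProduct.assoc K M.carrier C C).toLinearMap ∘ₗ (i.rTensor C).rTensor C)
        (by ext; simp)
    have e2 : ∀ t, i.rTensor (C ⊗[K] C) ((CoalgebraStruct.comul (R := K)).lTensor W t) =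
        CoalgebraStruct.comul.lTensor M.carrier (i.rTensor C t) := fun t => by
      rw [← LinearMap.comp_apply, ← LinearMap.comp_apply, LinearMap.rTensor_comp_lTensor,
        LinearMap.lTensor_comp_rTensor]
    ext w
    apply Module.Flat.rTensor_preserves_injective_linearMap (M := C ⊗[K] C) i hi
    have h := LinearMap.congr_fun M.coassoc (i w)
    simp only [LinearMap.comp_apply, LinearEquiv.coe_coe] at h ⊢
    rw [e1, e2, ← LinearMap.rTensor_comp_apply, hρ, LinearMap.rTensor_comp_apply, hρ', h]
  counit_coact := by
    ext w
    apply hi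
    have h : ∀ t : W ⊗[K] C, i (TensorProduct.rid K W (CoalgebraStruct.counit.lTensor W t)) =
        TensorProduct.rid K M.carrier (CoalgebraStruct.counit.lTensor M.carrier (i.rTensor C t)) := by
      intro t
      induction t with
      | zero => simp
      | add t t' h h' => simp only [map_add, h, h']
      | tmul x y => simp
    have hρ' : i.rTensor C (ρ w) = M.coact (i w) := LinearMap.congr_fun hρ w
    refine (h (ρ w)).trans ?_
    rw [hρ', counit_coact_apply]
    rfl

/-- Over a field tensoring is exact, so the linear kernel is a subcomodule; its inclusion and the
zero map agree after composing with f. -/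
lemma injective_of_mono {M N : RightComod K C} (f : M ⟶ N) [Mono f] :
    Function.Injective (Hom.toLin f) := by
  rw [← LinearMap.ker_eq_bot]
  let W := LinearMap.ker (Hom.toLin f)
  -- A linear retraction p onto the kernel serves only to write down the restricted coaction.
  obtain ⟨p, hp⟩ := W.subtype.exists_leftInverse_of_injective W.ker_subtype
  have hρ : W.subtype.rTensor C ∘ₗ (p.rTensor C ∘ₗ M.coact ∘ₗ W.subtype) =
      M.coact ∘ₗ W.subtype := by
    ext w
    obtain ⟨t, ht⟩ : M.coact w ∈ Set.range (W.subtype.rTensor C) := by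
      refine (Module.Flat.rTensor_exact C (LinearMap.exact_subtype_ker_map (Hom.toLin f)) _).1 ?_
      have := LinearMap.congr_fun f.comm w.1
      simp only [LinearMap.comp_apply] at this
      rw [← this, LinearMap.mem_ker.1 w.2, map_zero]
    simp only [LinearMap.comp_apply, Submodule.subtype_apply]
    rw [← ht, ← LinearMap.rTensor_comp_apply C p, hp, LinearMap.rTensor_id, LinearMap.id_apply]
  let k : M.ofInjective W.subtype W.subtype_injective _ hρ ⟶ M := Hom.mk W.subtype hρ.symm
  let z : M.ofInjective W.subtype W.subtype_injective _ hρ ⟶ M := Hom.mk 0 (by simp)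
  have hkz : k = z := by
    rw [← cancel_mono f]
    apply hom_ext
    ext w
    exact (LinearMap.mem_ker.1 w.2).trans (map_zero (Hom.toLin f)).symm
  rw [eq_bot_iff]
  intro w hw
  exact LinearMap.congr_fun (congrArg Hom.toLin hkz) (⟨w, hw⟩ : W)

/-- Colinear maps into `C` are functionals, and functionals extend along injections. -/
instance injective_regular : Injective (regular K C) where
  factors {X Y} g i _ := by
    obtain ⟨ψ, hψ⟩ := LinearMap.exists_extend_of_injective (injective_of_mono i)
      (CoalgebraStruct.counit ∘ₗ regularLin g)
    refine ⟨Y.toRegular ψ, regular_hom_ext ?_⟩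
    change (CoalgebraStruct.counit ∘ₗ regularLin (Y.toRegular ψ)) ∘ₗ Hom.toLin i = _
    rw [counit_comp_toRegular, hψ]

end Field

end RightComod

/-! ### Left comodules: monomorphisms and a criterion for injectivity. -/

namespace LeftComod

variable {K : Type u} [Field K] {C : Type v} [AddCommGroup C] [Module K C] [Coalgebra K C]

lemma hom_ext {M N : LeftComod K C} {f g : M ⟶ N} (h : Hom.toLin f = Hom.toLin g) : f = g :=
  Hom.ext h

lemma counit_coact_apply (M : LeftComod K C) (m : M.carrier) :
    TensorProduct.lid K M.carrier (CoalgebraStruct.counit.rTensor M.carrier (M.coact m)) = m :=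
  LinearMap.congr_fun M.counit_coact m

/-- An injective linear map whose range is stable under the coaction is the inclusion of a
subcomodule. -/
noncomputable def ofInjective (M : LeftComod K C) {W : Type v} [AddCommGroup W] [Module K W]
    (i : W →ₗ[K] M.carrier) (hi : Function.Injective i) (ρ : W →ₗ[K] C ⊗[K] W)
    (hρ : i.lTensor C ∘ₗ ρ = M.coact ∘ₗ i) : LeftComod K C where
  carrier := W
  coact := ρ
  coassoc := by
    have hρ' (w) : i.lTensor C (ρ w) = M.coact (i w) := LinearMap.congr_fun hρ w
    have e1 : ∀ t, (i.lTensor C).lTensor C (TensorProduct.assoc K C C W t) =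
        TensorProduct.assoc K C C M.carrier (i.lTensor (C ⊗[K] C) t) :=
      LinearMap.congr_fun
        (f := (i.lTensor C).lTensor C ∘ₗ (TensorProduct.assoc K C C W).toLinearMap)
        (g := (TensorProduct.assoc K C C M.carrier).toLinearMap ∘ₗ i.lTensor (C ⊗[K] C))
        (by ext; simp)
    have e2 : ∀ t, i.lTensor (C ⊗[K] C) ((CoalgebraStruct.comul (R := K)).rTensor W t) =
        CoalgebraStruct.comul.rTensor M.carrier (i.lTensor C t) := fun t => by
      rw [← LinearMap.comp_apply, ← LinearMap.comp_apply, LinearMap.rTensor_comp_lTensor,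
        LinearMap.lTensor_comp_rTensor]
    ext w
    apply Module.Flat.lTensor_preserves_injective_linearMap (M := C) (i.lTensor C)
      (Module.Flat.lTensor_preserves_injective_linearMap (M := C) i hi)
    have h := LinearMap.congr_fun M.coassoc (i w)
    simp only [LinearMap.comp_apply, LinearEquiv.coe_coe] at h ⊢
    rw [e1, e2, ← LinearMap.lTensor_comp_apply, hρ, LinearMap.lTensor_comp_apply, hρ', h]
  counit_coact := by
    ext w
    apply hi
    have h : ∀ t : C ⊗[K] W, i (TensorProduct.lid K W (CoalgebraStruct.counit.rTensor W t)) =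
        TensorProduct.lid K M.carrier (CoalgebraStruct.counit.rTensor M.carrier (i.lTensor C t)) := by
      intro t
      induction t with
      | zero => simp
      | add t t' h h' => simp only [map_add, h, h']
      | tmul x y => simp
    have hρ' : i.lTensor C (ρ w) = M.coact (i w) := LinearMap.congr_fun hρ w
    refine (h (ρ w)).trans ?_
    rw [hρ', counit_coact_apply]
    rfl

lemma injective_of_mono {M N : LeftComod K C} (f : M ⟶ N) [Mono f] :
    Function.Injective (Hom.toLin f) := by
  rw [← LinearMap.ker_eq_bot]
  let W := LinearMap.ker (Hom.toLin f)
  obtain ⟨p, hp⟩ := W.subtype.exists_leftInverse_of_injective W.ker_subtype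
  have hρ : W.subtype.lTensor C ∘ₗ (p.lTensor C ∘ₗ M.coact ∘ₗ W.subtype) =
      M.coact ∘ₗ W.subtype := by
    ext w
    obtain ⟨t, ht⟩ : M.coact w ∈ Set.range (W.subtype.lTensor C) := by
      refine (Module.Flat.lTensor_exact C (LinearMap.exact_subtype_ker_map (Hom.toLin f)) _).1 ?_
      have := LinearMap.congr_fun f.comm w.1
      simp only [LinearMap.comp_apply] at this
      rw [← this, LinearMap.mem_ker.1 w.2, map_zero]
    simp only [LinearMap.comp_apply, Submodule.subtype_apply]
    rw [← ht, ← LinearMap.lTensor_comp_apply C p, hp, LinearMap.lTensor_id, LinearMap.id_apply]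
  let k : M.ofInjective W.subtype W.subtype_injective _ hρ ⟶ M := Hom.mk W.subtype hρ.symm
  let z : M.ofInjective W.subtype W.subtype_injective _ hρ ⟶ M := Hom.mk 0 (by simp)
  have hkz : k = z := by
    rw [← cancel_mono f]
    apply hom_ext
    ext w
    exact (LinearMap.mem_ker.1 w.2).trans (map_zero (Hom.toLin f)).symm
  rw [eq_bot_iff]
  intro w hw
  exact LinearMap.congr_fun (congrArg Hom.toLin hkz) (⟨w, hw⟩ : W)

lemma lTensor_comp_coassoc (M : LeftComod K C) {V : Type v} [AddCommGroup V] [Module K V]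
    (g : M.carrier →ₗ[K] V) :
    (TensorProduct.assoc K C C V).toLinearMap ∘ₗ CoalgebraStruct.comul.rTensor V ∘ₗ
      g.lTensor C ∘ₗ M.coact = (g.lTensor C ∘ₗ M.coact).lTensor C ∘ₗ M.coact := by
  have h : (TensorProduct.assoc K C C V).toLinearMap ∘ₗ g.lTensor (C ⊗[K] C) =
      (g.lTensor C).lTensor C ∘ₗ (TensorProduct.assoc K C C M.carrier).toLinearMap := by
    ext; simp
  rw [LinearMap.lTensor_comp, LinearMap.comp_assoc, ← M.coassoc,
    ← LinearMap.comp_assoc _ _ (LinearMap.lTensor C (LinearMap.lTensor C g)), ← h,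
    LinearMap.comp_assoc, ← LinearMap.comp_assoc M.coact, LinearMap.rTensor_comp_lTensor,
    ← LinearMap.comp_assoc M.coact _ (LinearMap.lTensor (C ⊗[K] C) g),
    LinearMap.lTensor_comp_rTensor]

/-- A left comodule whose coaction `M → C ⊗ M` has a colinear retraction is injective. -/
lemma injective_of_retraction (M : LeftComod K C) (r : C ⊗[K] M.carrier →ₗ[K] M.carrier)
    (hr : M.coact ∘ₗ r = r.lTensor C ∘ₗ (TensorProduct.assoc K C C M.carrier).toLinearMap ∘ₗ
      CoalgebraStruct.comul.rTensor M.carrier)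
    (hid : r ∘ₗ M.coact = LinearMap.id) : Injective M where
  factors {X Y} g i _ := by
    obtain ⟨g', hg'⟩ := LinearMap.exists_extend_of_injective (injective_of_mono i) (Hom.toLin g)
    -- The extension is y ↦ r(y₋₁ ⊗ g'(y₀)); g' need only be linear.
    refine ⟨Hom.mk (r ∘ₗ g'.lTensor C ∘ₗ Y.coact) ?_, ?_⟩
    · rw [← LinearMap.comp_assoc, hr, LinearMap.comp_assoc, LinearMap.comp_assoc,
        lTensor_comp_coassoc, LinearMap.lTensor_comp C r, LinearMap.comp_assoc]
    · apply hom_ext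
      change (r ∘ₗ g'.lTensor C ∘ₗ Y.coact) ∘ₗ Hom.toLin i = Hom.toLin g
      rw [LinearMap.comp_assoc, LinearMap.comp_assoc, i.comm, ← LinearMap.comp_assoc X.coact,
        ← LinearMap.lTensor_comp, hg', ← g.comm, ← LinearMap.comp_assoc, hid, LinearMap.id_comp]

end LeftComod

/-! ### Consequences of the adjunctions: η, β and the retraction. -/

namespace RightComod

section Frobenius

variable {K : Type u} [Field K] {C D : Type v}
    [AddCommGroup C] [Module K C] [Coalgebra K C] [AddCommGroup D] [Module K D] [Coalgebra K D]
    (f : C →ₗc[K] D)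

/-- A coalgebra morphism, as a colinear map over its target. -/
def corestrictRegularHom : (corestriction f).obj (regular K C) ⟶ regular K D :=
  Hom.mk f.toLinearMap <| by
    change CoalgebraStruct.comul ∘ₗ f.toLinearMap =
      f.toLinearMap.rTensor D ∘ₗ f.toLinearMap.lTensor C ∘ₗ CoalgebraStruct.comul
    rw [← LinearMap.comp_assoc, LinearMap.rTensor_comp_lTensor, f.map_comp_comul]

variable {f} {R : RightComod K D ⥤ RightComod K C} (adj : corestriction f ⊣ R)

/-- The counit of an adjunction `corestriction f ⊣ R`, as a linear map. -/
def counitLin (X : RightComod K D) : (R.obj X).carrier →ₗ[K] X.carrier :=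
  Hom.toLin (adj.counit.app X)

lemma counitLin_comp_map {X Y : RightComod K D} (g : X ⟶ Y) :
    counitLin adj Y ∘ₗ Hom.toLin (R.map g) = Hom.toLin g ∘ₗ counitLin adj X :=
  congrArg Hom.toLin (adj.counit.naturality g)

lemma hom_ext_of_counitLin {M : RightComod K C} {X : RightComod K D} {a b : M ⟶ R.obj X}
    (h : counitLin adj X ∘ₗ Hom.toLin a = counitLin adj X ∘ₗ Hom.toLin b) : a = b := by
  apply (adj.homEquiv M X).symm.injective
  rw [Adjunction.homEquiv_counit, Adjunction.homEquiv_counit]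
  exact hom_ext h

/-- The colinear map `C → R D` corresponding to `f : C → D`. -/
def regularToObj : regular K C ⟶ R.obj (regular K D) :=
  adj.homEquiv _ _ (corestrictRegularHom f)

/-- The linear map underlying `regularToObj`. -/
def regularToObjLin : C →ₗ[K] (R.obj (regular K D)).carrier := Hom.toLin (regularToObj adj)

/-- The counit at the regular comodule, as a linear map into `D`. -/
def counitRegularLin : (R.obj (regular K D)).carrier →ₗ[K] D :=
  counitLin adj (regular K D)

lemma counitRegularLin_comp_regularToObjLin :
    counitRegularLin adj ∘ₗ regularToObjLin adj = f.toLinearMap := by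
  have h := (adj.homEquiv (regular K C) (regular K D)).symm_apply_apply (corestrictRegularHom f)
  rw [Adjunction.homEquiv_counit] at h
  exact congrArg Hom.toLin h

/-- The colinear map `R D → C` determined by `ε ∘ counit`. -/
noncomputable def objToRegular : R.obj (regular K D) ⟶ regular K C :=
  (R.obj (regular K D)).toRegular (CoalgebraStruct.counit ∘ₗ counitRegularLin adj)

/-- Both sides are right `D`-colinear maps into `D` with the same composite with the counit of `D`.
-/
lemma toLinearMap_comp_objToRegular :
    f.toLinearMap ∘ₗ regularLin (objToRegular adj) = counitRegularLin adj := by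
  have h : (corestriction f).map (objToRegular adj) ≫ corestrictRegularHom f =
      adj.counit.app _ := by
    apply regular_hom_ext
    change CoalgebraStruct.counit ∘ₗ f.toLinearMap ∘ₗ regularLin (objToRegular adj) = _
    rw [← LinearMap.comp_assoc, f.counit_comp, objToRegular, counit_comp_toRegular]
    rfl
  exact congrArg Hom.toLin h

lemma regularToObj_objToRegular : regularToObj adj ≫ objToRegular adj = 𝟙 _ := by
  apply regular_hom_ext
  change (CoalgebraStruct.counit ∘ₗ regularLin (objToRegular adj)) ∘ₗ
    regularToObjLin adj = (CoalgebraStruct.counit (R := K) (A := C)) ∘ₗ LinearMap.id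
  rw [objToRegular, counit_comp_toRegular, LinearMap.comp_id, ← f.counit_comp,
    ← counitRegularLin_comp_regularToObjLin adj, LinearMap.comp_assoc]

/-- A colinear endomorphism of the regular comodule `C`, given by `c ↦ φ(c₁) c₂`. -/
noncomputable def hitRightHom {C : Type v} [AddCommGroup C] [Module K C] [Coalgebra K C]
    (φ : C →ₗ[K] K) : regular K C ⟶ regular K C := (regular K C).toRegular φ

lemma counit_comp_hitRight {C : Type v} [AddCommGroup C] [Module K C] [Coalgebra K C]
    (φ : C →ₗ[K] K) : CoalgebraStruct.counit ∘ₗ hitRight φ = φ :=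
  counit_comp_toRegular (regular K C) φ

variable (adj' : R ⊣ corestriction f)

/-- The unit `D → R D ≅ C`, for a two-sided adjoint `R` of the corestriction. -/
noncomputable def unitRegular : regular K D ⟶ (corestriction f).obj (regular K C) :=
  adj'.unit.app (regular K D) ≫ (corestriction f).map (objToRegular adj)

/-- The linear map underlying `unitRegular`. -/
noncomputable def unitLin : D →ₗ[K] C := Hom.toLin (unitRegular adj adj')

/-- Naturality of the unit in the endomorphisms d ↦ φ(d₁)d₂ gives η(φ(d₁)d₂) = φ(f(η(d)₁))η(d)₂.
Functionals φ on the left factor separate tensors, so this is left colinearity. -/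
lemma unitLin_left_colinear :
    f.toLinearMap.rTensor C ∘ₗ CoalgebraStruct.comul ∘ₗ unitLin adj adj' =
      (unitLin adj adj').lTensor D ∘ₗ CoalgebraStruct.comul := by
  have key (φ : D →ₗ[K] K) : unitLin adj adj' ∘ₗ hitRight φ =
      hitRight (φ ∘ₗ f.toLinearMap) ∘ₗ unitLin adj adj' := by
    have h1 : R.map (hitRightHom φ) ≫ objToRegular adj =
        objToRegular adj ≫ hitRightHom (φ ∘ₗ f.toLinearMap) := by
      apply regular_hom_ext
      change (CoalgebraStruct.counit ∘ₗ regularLin (objToRegular adj)) ∘ₗ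
        Hom.toLin (R.map (hitRightHom φ)) = (CoalgebraStruct.counit ∘ₗ
          hitRight (φ ∘ₗ f.toLinearMap)) ∘ₗ regularLin (objToRegular adj)
      rw [counit_comp_hitRight, LinearMap.comp_assoc _ _ φ, toLinearMap_comp_objToRegular,
        objToRegular, counit_comp_toRegular]
      have h2 : counitRegularLin adj ∘ₗ Hom.toLin (R.map (hitRightHom φ)) =
        hitRight φ ∘ₗ counitRegularLin adj := counitLin_comp_map adj (hitRightHom φ)
      rw [LinearMap.comp_assoc, h2, ← LinearMap.comp_assoc, counit_comp_hitRight]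
    have h3 : hitRightHom φ ≫ unitRegular adj adj' = unitRegular adj adj' ≫
        (corestriction f).map (hitRightHom (φ ∘ₗ f.toLinearMap)) := by
      rw [unitRegular, Category.assoc, ← Functor.map_comp, ← h1, Functor.map_comp]
      exact (adj'.unit_naturality_assoc (hitRightHom φ)
        ((corestriction f).map (objToRegular adj))).symm
    exact congrArg Hom.toLin h3
  ext d
  apply TensorProduct.eq_of_forall_dual_rTensor
  intro φ
  apply (TensorProduct.lid K C).injective
  have h := LinearMap.congr_fun (key φ) d
  simp only [hitRight, LinearMap.comp_apply, LinearEquiv.coe_coe] at h ⊢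
  rw [← LinearMap.rTensor_comp_apply, ← h]
  generalize CoalgebraStruct.comul (R := K) d = t
  induction t with
  | zero => simp
  | add t t' h h' => simp only [map_add, h, h']
  | tmul x y => simp

lemma exists_hitTensor_unitLin : ∃ β : C ⊗[K] C →ₗ[K] K,
    (hitTensor β ∘ₗ (unitLin adj adj').rTensor C) ∘ₗ
      f.toLinearMap.rTensor C ∘ₗ CoalgebraStruct.comul = LinearMap.id := by
  let A := regular K C
  let UA := (corestriction f).obj A
  let e : (R.obj UA).carrier →ₗ[K] C := counitLin adj UA
  let ε : (R.obj UA).carrier →ₗ[K] C := regularLin (adj'.counit.app A)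
  let j : R.obj UA ⟶ cofree C C := (R.obj UA).toCofree e
  let jl : (R.obj UA).carrier →ₗ[K] C ⊗[K] C := e.rTensor C ∘ₗ (R.obj UA).coact
  -- Applying ε to the right factor of `j` returns `e`, and a colinear map into R U C is determined
  -- by its composite with `e`.
  have hmono : Mono j := ⟨fun {M} a b hab => by
    apply hom_ext_of_counitLin adj
    have h0 (a : M ⟶ R.obj UA) (m : M.carrier) : TensorProduct.rid K C
        (CoalgebraStruct.counit.lTensor C (Hom.toLin (a ≫ j) m)) = e (Hom.toLin a m) :=
      rid_counit_rTensor_coact (R.obj UA) e (Hom.toLin a m)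
    ext m
    refine (h0 a m).symm.trans (Eq.trans ?_ (h0 b m))
    rw [hab]⟩
  -- β is any linear extension to C ⊗ C of the functional that the counit of `R ⊣ U` induces on R U
  -- C.
  obtain ⟨β, hβ⟩ : ∃ β : C ⊗[K] C →ₗ[K] K, β ∘ₗ jl = CoalgebraStruct.counit ∘ₗ ε :=
    LinearMap.exists_extend_of_injective (i := jl) (injective_of_mono j) _
  have hj {M : RightComod K C} (a : M ⟶ R.obj UA) :
      jl ∘ₗ Hom.toLin a = (e ∘ₗ Hom.toLin a).rTensor C ∘ₗ M.coact := by
    rw [LinearMap.comp_assoc, Hom.comm, LinearMap.rTensor_comp, LinearMap.comp_assoc]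
  -- Test against φ: by naturality φ ∘ ε is the functional of hβ precomposed with the endomorphism
  -- of R U C induced by `hitRight φ`, which `jl` carries to `hitRight φ` on the left factor.
  have hε : ε = hitTensor β ∘ₗ jl := by
    ext x
    rw [← sub_eq_zero, ← Module.forall_dual_apply_eq_zero_iff K]
    intro φ
    have h1 : ε ∘ₗ Hom.toLin (R.map ((corestriction f).map (hitRightHom φ))) = hitRight φ ∘ₗ ε :=
      congrArg Hom.toLin (adj'.counit.naturality (hitRightHom φ))
    have h2 : e ∘ₗ Hom.toLin (R.map ((corestriction f).map (hitRightHom φ))) = hitRight φ ∘ₗ e :=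
      counitLin_comp_map adj ((corestriction f).map (hitRightHom φ))
    have h3 : jl ∘ₗ Hom.toLin (R.map ((corestriction f).map (hitRightHom φ))) =
        (hitRight φ).rTensor C ∘ₗ jl := by
      rw [hj, h2, LinearMap.rTensor_comp, LinearMap.comp_assoc]
    have h4 : φ ∘ₗ ε = β ∘ₗ (hitRight φ).rTensor C ∘ₗ jl := by
      rw [← h3, ← LinearMap.comp_assoc, hβ, LinearMap.comp_assoc, h1, ← LinearMap.comp_assoc,
        counit_comp_hitRight]
    have h5 := LinearMap.congr_fun h4 x
    simp only [LinearMap.comp_apply] at h5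
    rw [map_sub, LinearMap.comp_apply, dual_hitTensor, h5, sub_self]
  refine ⟨β, ?_⟩
  -- The composite C → R D → R U C: the counit sends it to the identity, while `jl` sends it to c ↦
  -- η(f(c₁)) ⊗ c₂.
  let x : A ⟶ R.obj UA := regularToObj adj ≫ R.map (unitRegular adj adj')
  have hx : x ≫ adj'.counit.app A = 𝟙 A := by
    have h : R.map (unitRegular adj adj') ≫ adj'.counit.app A = objToRegular adj :=
      adj'.map_unit_comp_map_comp_counit (objToRegular adj)
    rw [Category.assoc, h, regularToObj_objToRegular]
  let xl : C →ₗ[K] (R.obj UA).carrier := Hom.toLin x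
  have hex : e ∘ₗ xl = unitLin adj adj' ∘ₗ f.toLinearMap := by
    have h1 : e ∘ₗ Hom.toLin (R.map (unitRegular adj adj')) =
      unitLin adj adj' ∘ₗ counitRegularLin adj := counitLin_comp_map adj _
    change (e ∘ₗ Hom.toLin (R.map (unitRegular adj adj'))) ∘ₗ regularToObjLin adj = _
    rw [h1, LinearMap.comp_assoc, counitRegularLin_comp_regularToObjLin]
  have hjx : jl ∘ₗ xl = (e ∘ₗ xl).rTensor C ∘ₗ CoalgebraStruct.comul := hj x
  rw [LinearMap.comp_assoc, ← LinearMap.comp_assoc _ _ ((unitLin adj adj').rTensor C),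
    ← LinearMap.rTensor_comp, ← hex, ← hjx, ← LinearMap.comp_assoc, ← hε]
  exact congrArg Hom.toLin hx

end Frobenius

end RightComod

theorem proposition3p5 {K : Type u} [Field K] {C D : Type v}
    [AddCommGroup C] [Module K C] [Coalgebra K C] [AddCommGroup D] [Module K D] [Coalgebra K D]
    (f : C →ₗc[K] D) (hf : f.IsFrobeniusExtension) :
    CategoryTheory.Injective (LeftComod.corestrict f (LeftComod.regular K C)) ∧
      CategoryTheory.Injective (RightComod.corestrict f (RightComod.regular K C)) := by
  obtain ⟨L, R, ⟨adjL⟩, ⟨adj⟩, ⟨e⟩⟩ := hf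
  let adj' := adjL.ofNatIsoLeft e
  constructor
  · obtain ⟨β, hβ⟩ := RightComod.exists_hitTensor_unitLin adj adj'
    exact LeftComod.injective_of_retraction _ _ (hitTensor_comp_rTensor_colinear f.toLinearMap _ β
      (RightComod.unitLin_left_colinear adj adj')) hβ
  · have := Functor.preservesMonomorphisms_of_adjunction adj
    exact Injective.injective_of_adjoint adj' (RightComod.regular K C)
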